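/- \begin{theorem} Let $n\ge 1$. A Jacobi matrix is a real symmetric $n\times n$ tridiagonal matrix whose entries $J_{ij}$ with $|i-j|=1$ are all positive. The set of $n\times n$ Jacobi matrices (an open subset of the vector space of real symmetric tridiagonal matrices) is diffeomorphic to the product \[ \{(\lambda_1,\ldots,\lambda_n)\in\mathbb{R}^n \,;\, \lambda_1<\lambda_2<\ldots<\lambda_n\}\times\{(v_1,\ldots,v_n)\in\mathbb{R}^n \,;\, v_i>0,\ \sum_i v_i^2=1\}. \] More precisely, there is a $C^\infty$ diffeomorphism which takes $J$ to the increasing list $(\lambda_1,\ldots,\lambda_n)$ of its eigenvalues and to the vector $(v_1,\ldots,v_n)$, where $v_i$ is the first coordinate of the eigenvector of $J$ associated to $\lambda_i$, normalized so as to have Euclidean norm $1$ and positive first coordinate. Its inverse is given as follows: for $\Lambda=\operatorname{diag}(\lambda_1,\ldots,\lambda_n)$ and $v=(v_1,\ldots,v_n)$, the vectors $q_1=v,q_2,\ldots,q_n$ obtained from the sequence $v,\Lambda v,\ldots,\Lambda^{n-1}v$ by Gram--Schmidt orthonormalization are the columns of an orthogonal matrix $Q$, and $J=Q^T\Lambda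 Q$. \end{theorem} -/

import Mathlib

open scoped Manifold ContDiff Matrix

/-- The real vector space of symmetric tridiagonal `n × n` matrices, as a subspace of the normed
space of real arrays (Mathlib puts no canonical norm on `Matrix`; in finite dimension all norms
give the same topology and the same smooth functions). -/
def SymTridiagonal (n : ℕ) : Submodule ℝ (Fin n → Fin n → ℝ) where
  carrier := {A | (Matrix.of A).IsSymm ∧
    ∀ i j : Fin n, ((i : ℕ) + 1 < j ∨ (j : ℕ) + 1 < i) → A i j = 0}
  add_mem' := by
    rintro A B ⟨hA, hA'⟩ ⟨hB, hB'⟩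
    exact ⟨hA.add hB, fun i j h => by simp [hA' i j h, hB' i j h]⟩
  zero_mem' := ⟨Matrix.isSymm_zero, fun _ _ _ => rfl⟩
  smul_mem' := by
    rintro c A ⟨hA, hA'⟩
    exact ⟨hA.smul c, fun i j h => by simp [hA' i j h]⟩

/-- A Jacobi matrix: real, symmetric, tridiagonal, with positive principal off-diagonal
entries. -/
def IsJacobi {n : ℕ} (A : Matrix (Fin n) (Fin n) ℝ) : Prop :=
  A.IsSymm ∧
  (∀ i j : Fin n, ((i : ℕ) + 1 < j ∨ (j : ℕ) + 1 < i) → A i j = 0) ∧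
  (∀ i j : Fin n, ((i : ℕ) + 1 = j ∨ (j : ℕ) + 1 = i) → 0 < A i j)

/-- The set of `n × n` Jacobi matrices, an open subset of the vector space of symmetric
tridiagonal matrices; its smooth structure is the one induced from that vector space. -/
def JacobiMatrices (n : ℕ) : TopologicalSpace.Opens (SymTridiagonal n) where
  carrier := {A | IsJacobi (Matrix.of A.1)}
  is_open' := by
    have h : {A : SymTridiagonal n | IsJacobi (Matrix.of A.1)} =
        ⋂ i : Fin n, ⋂ j : Fin n, ⋂ _ : ((i : ℕ) + 1 = j ∨ (j : ℕ) + 1 = i),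
          {A : SymTridiagonal n | 0 < A.1 i j} := by
      ext A
      simp only [Set.mem_iInter]
      exact ⟨fun hA => hA.2.2, fun hA => ⟨A.2.1, A.2.2, hA⟩⟩
    rw [h]
    exact isOpen_iInter_of_finite fun i => isOpen_iInter_of_finite fun j =>
      isOpen_iInter_of_finite fun _ => isOpen_lt continuous_const
        ((continuous_apply_apply i j).comp continuous_subtype_val)

/-- The matrix underlying a point of `JacobiMatrices n`. -/
def jacobiToMatrix {n : ℕ} (J : JacobiMatrices n) : Matrix (Fin n) (Fin n) ℝ :=
  Matrix.of J.1.1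

/-- The open set `{(λ₁, …, λₙ) ; λ₁ < λ₂ < … < λₙ}` in `ℝⁿ`. -/
def OrderedTuples (n : ℕ) : TopologicalSpace.Opens (EuclideanSpace ℝ (Fin n)) where
  carrier := {l | StrictMono fun i => l i}
  is_open' := by
    have h : {l : EuclideanSpace ℝ (Fin n) | StrictMono fun i => l i} =
        ⋂ i : Fin n, ⋂ j : Fin n, ⋂ _ : i < j, {l : EuclideanSpace ℝ (Fin n) | l i < l j} := by
      ext l
      simp only [Set.mem_iInter]
      exact ⟨fun h i j hij => h hij, fun h i j hij => h i j hij⟩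
    rw [h]
    exact isOpen_iInter_of_finite fun i => isOpen_iInter_of_finite fun j =>
      isOpen_iInter_of_finite fun _ => isOpen_lt (by fun_prop) (by fun_prop)

/-- The open positive part `{v ; vᵢ > 0, ∑ vᵢ² = 1}` of the unit sphere of `ℝⁿ⁺¹`. -/
def PositiveSphere (n : ℕ) :
    TopologicalSpace.Opens (Metric.sphere (0 : EuclideanSpace ℝ (Fin (n + 1))) 1) where
  carrier := {v | ∀ i, 0 < (v : EuclideanSpace ℝ (Fin (n + 1))) i}
  is_open' := by
    simp only [Set.ofPred_forall]
    exact isOpen_iInter_of_finite fun i => isOpen_lt continuous_const (by fun_prop)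

/-- The Krylov sequence `v, Λ v, …, Λⁿ⁻¹ v` with `Λ = diag(l₁, …, lₙ)`. -/
noncomputable def krylov {n : ℕ} (l v : EuclideanSpace ℝ (Fin n)) (k : Fin n) :
    EuclideanSpace ℝ (Fin n) :=
  WithLp.toLp 2 ((Matrix.diagonal fun i => l i) ^ (k : ℕ) *ᵥ fun i => v i)

/-- The matrix `Q` whose `k`-th column is the `k`-th vector obtained from the Krylov sequence
by Gram–Schmidt orthonormalization. -/
noncomputable def lanczosMatrix {n : ℕ} (l v : EuclideanSpace ℝ (Fin n)) :
    Matrix (Fin n) (Fin n) ℝ :=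
  Matrix.of fun i k => InnerProductSpace.gramSchmidtNormed ℝ (krylov l v) k i

/-! Row `k` of `A q = μ q` gives coordinate `k + 1` of `q` in terms of the earlier ones after
division by a positive off-diagonal entry, so an eigenvector is fixed by its first coordinate. Hence
the spectrum is simple, unit eigenvectors can be chosen with positive first coordinate, and the
factorization `A = Uᵀ diag(l) U` of `IsSpectralData` exists and is unique. The weights form the
first column of `U`.

Injectivity (`jacobi_eq`): the relation `U A = diag(l) U` is a three-term recurrence that rebuilds
the columns of `U` from `l` and the first column. Surjectivity (`isJacobi_lanczos`): the Krylov
vectors are independent by Vandermonde, and since `diag(l)` raises the Krylov index by one, it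
becomes a Jacobi matrix in the orthonormalized basis.

Smoothness of the inverse is that of Gram–Schmidt on independent vectors. In the forward direction
the eigenvalues are simple roots of the characteristic polynomial, so the implicit function theorem
applies (`eventually_spectrum_eq`). The squared weights solve a Vandermonde system whose right-hand
side consists of the moments `(A ^ j) 0 0`; Cramer's rule and a positive square root make them
smooth too. -/

/-! ### Rigidity of eigenvectors -/

/-- An eigenvector of a Jacobi matrix is determined by its first coordinate. -/
theorem IsJacobi.eq_zero_of_mulVec_eq_smul {n : ℕ} {A : Matrix (Fin (n + 1)) (Fin (n + 1)) ℝ}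
    (hA : IsJacobi A) {μ : ℝ} {q : Fin (n + 1) → ℝ} (hq : A *ᵥ q = μ • q) (h0 : q 0 = 0) :
    q = 0 := by
  have key : ∀ k : ℕ, ∀ j : Fin (n + 1), (j : ℕ) ≤ k → q j = 0 := by
    intro k
    induction k with
    | zero =>
      intro j hj
      have : j = 0 := Fin.ext (by simpa using hj)
      rw [this, h0]
    | succ k ih =>
      intro j hj
      rcases Nat.lt_or_ge (j : ℕ) (k + 1) with h | h
      · exact ih j (by omega)
      · let i : Fin (n + 1) := ⟨k, by omega⟩
        have hi : (A *ᵥ q) i = μ * q i := by rw [hq]; rfl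
        -- In row `k` the terms up to column `k` vanish by induction and those beyond `k + 1` by
        -- tridiagonality; only the positive entry times `q j` is left.
        rw [ih i le_rfl, mul_zero, Matrix.mulVec, dotProduct, Finset.sum_eq_single j] at hi
        · exact (mul_eq_zero.mp hi).resolve_left (hA.2.2 i j (Or.inl (by simp [i]; omega))).ne'
        · intro m _ hm
          have hm' : (m : ℕ) ≠ j := fun e => hm (Fin.ext e)
          rcases Nat.lt_or_ge (m : ℕ) (k + 1) with h' | h'
          · rw [ih m (by omega), mul_zero]
          · rw [hA.2.1 i m (Or.inl (by simp [i]; omega)), zero_mul]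
        · simp
  funext j
  exact key j j le_rfl

/-! ### Spectral data: consequences and uniqueness -/

/-- Spectral data of a real symmetric matrix: its increasing eigenvalues together with the
orthogonal matrix whose rows are the eigenvectors with positive first coordinate. -/
structure IsSpectralData {n : ℕ} (A : Matrix (Fin (n + 1)) (Fin (n + 1)) ℝ)
    (l : Fin (n + 1) → ℝ) (U : Matrix (Fin (n + 1)) (Fin (n + 1)) ℝ) : Prop where
  strictMono : StrictMono l
  transpose_mul_self : Uᵀ * U = 1
  pos : ∀ i, 0 < U i 0
  eq : A = Uᵀ * Matrix.diagonal l * U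

namespace IsSpectralData

variable {n : ℕ} {A : Matrix (Fin (n + 1)) (Fin (n + 1)) ℝ} {l : Fin (n + 1) → ℝ}
  {U : Matrix (Fin (n + 1)) (Fin (n + 1)) ℝ}

theorem mul_transpose_self (h : IsSpectralData A l U) : U * Uᵀ = 1 :=
  mul_eq_one_comm.mp h.transpose_mul_self

theorem mul_eq (h : IsSpectralData A l U) : U * A = Matrix.diagonal l * U := by
  rw [h.eq, Matrix.mul_assoc, ← Matrix.mul_assoc U, h.mul_transpose_self, Matrix.one_mul]

theorem apply (h : IsSpectralData A l U) (j k : Fin (n + 1)) :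
    A j k = ∑ i, U i j * l i * U i k := by
  rw [h.eq, Matrix.mul_apply]
  simp [Matrix.mul_diagonal]

theorem sum_mul_self (h : IsSpectralData A l U) (k : Fin (n + 1)) : ∑ i, U i k * U i k = 1 := by
  have := congrFun (congrFun h.transpose_mul_self k) k
  simpa [Matrix.mul_apply] using this

theorem sum_row_mul_self (h : IsSpectralData A l U) (i : Fin (n + 1)) :
    ∑ k, U i k * U i k = 1 := by
  have := congrFun (congrFun h.mul_transpose_self i) i
  simpa [Matrix.mul_apply] using this

theorem mulVec_row (h : IsSpectralData A l U) (i : Fin (n + 1)) : A *ᵥ U i = l i • U i := by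
  have hs : Aᵀ = A := by
    rw [h.eq]
    simp [Matrix.transpose_mul, Matrix.mul_assoc]
  funext k
  have := congrFun (congrFun h.mul_eq i) k
  rw [Matrix.diagonal_mul, Matrix.mul_apply] at this
  rw [Pi.smul_apply, smul_eq_mul, ← this, Matrix.mulVec, dotProduct]
  refine Finset.sum_congr rfl fun j _ => ?_
  rw [← hs, Matrix.transpose_apply, hs, mul_comm]

theorem spectrum_eq (h : IsSpectralData A l U) : spectrum ℝ A = Set.range l := by
  let u : (Matrix (Fin (n + 1)) (Fin (n + 1)) ℝ)ˣ :=
    ⟨Uᵀ, U, h.transpose_mul_self, h.mul_transpose_self⟩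
  have : A = u * Matrix.diagonal l * (u⁻¹ : _ˣ) := h.eq
  rw [this, spectrum.units_conjugate, spectrum_diagonal]

theorem pow (h : IsSpectralData A l U) (j : ℕ) :
    A ^ j = Uᵀ * Matrix.diagonal (fun i => l i ^ j) * U := by
  let u : (Matrix (Fin (n + 1)) (Fin (n + 1)) ℝ)ˣ :=
    ⟨Uᵀ, U, h.transpose_mul_self, h.mul_transpose_self⟩
  have : A = u * Matrix.diagonal l * (u⁻¹ : _ˣ) := h.eq
  rw [this, Units.conj_pow, Matrix.diagonal_pow]
  rfl

/-- The spectral measure of the first basis vector has the moments `(A ^ j) 0 0`. -/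
theorem pow_apply_zero_zero (h : IsSpectralData A l U) (j : ℕ) :
    (A ^ j) 0 0 = ∑ i, l i ^ j * U i 0 ^ 2 := by
  rw [h.pow, Matrix.mul_apply]
  refine Finset.sum_congr rfl fun i _ => ?_
  rw [Matrix.mul_diagonal, Matrix.transpose_apply]
  ring

/-- This factored form exhibits the eigenvalues as simple roots, as the implicit function theorem
needs. -/
theorem charpoly_eq (h : IsSpectralData A l U) (x : ℝ) :
    (Matrix.scalar _ x - A).det = ∏ i, (x - l i) := by
  have : Matrix.scalar _ x - A = Uᵀ * (Matrix.diagonal fun i => x - l i) * U := by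
    have e : (Matrix.diagonal fun i => x - l i) = Matrix.scalar _ x - Matrix.diagonal l := by
      ext i j
      by_cases hij : i = j <;> simp [hij, Matrix.diagonal]
    rw [e, Matrix.mul_sub, Matrix.sub_mul, ← h.eq, Matrix.scalar_apply,
      ← Matrix.smul_one_eq_diagonal]
    simp [h.transpose_mul_self]
  rw [this, Matrix.det_mul, Matrix.det_mul, Matrix.det_diagonal, mul_comm, ← mul_assoc,
    ← Matrix.det_mul, h.mul_transpose_self, Matrix.det_one, one_mul]

theorem eigenvalues_unique {l' : Fin (n + 1) → ℝ} {U' : Matrix (Fin (n + 1)) (Fin (n + 1)) ℝ}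
    (h : IsSpectralData A l U) (h' : IsSpectralData A l' U') : l = l' :=
  (h.strictMono.range_inj h'.strictMono).mp (h.spectrum_eq.symm.trans h'.spectrum_eq)

/-- The combination `U i 0 • q - q 0 • U i` solves the eigenvalue equation with zero first
coordinate, so it vanishes. Thus the two vectors are proportional; equal norms and positive first
coordinates force equality. -/
theorem eq_row (hA : IsJacobi A) (h : IsSpectralData A l U) {i : Fin (n + 1)}
    {q : Fin (n + 1) → ℝ} (hq : A *ᵥ q = l i • q) (h1 : ∑ k, q k * q k = 1) (h0 : 0 < q 0) :
    q = U i := by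
  have hz : U i 0 • q - q 0 • U i = 0 := by
    refine hA.eq_zero_of_mulVec_eq_smul (μ := l i) ?_ (by simp [mul_comm])
    rw [Matrix.mulVec_sub, Matrix.mulVec_smul, Matrix.mulVec_smul, hq, h.mulVec_row, smul_sub,
      smul_comm (l i), smul_comm (l i)]
  have hk : ∀ k, U i 0 * q k = q 0 * U i k := fun k => by
    simpa using sub_eq_zero.mp (congrFun hz k)
  have hsq : U i 0 ^ 2 = q 0 ^ 2 := by
    calc U i 0 ^ 2 = U i 0 ^ 2 * ∑ k, q k * q k := by rw [h1, mul_one]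
      _ = ∑ k, (U i 0 * q k) * (U i 0 * q k) := by
        rw [Finset.mul_sum]; exact Finset.sum_congr rfl fun k _ => by ring
      _ = q 0 ^ 2 * ∑ k, U i k * U i k := by
        rw [Finset.mul_sum]; exact Finset.sum_congr rfl fun k _ => by rw [hk]; ring
      _ = q 0 ^ 2 := by rw [h.sum_row_mul_self, mul_one]
  have he : U i 0 = q 0 := (pow_left_inj₀ (h.pos i).le h0.le two_ne_zero).mp hsq
  funext k
  have := hk k
  rw [he] at this
  exact mul_left_cancel₀ h0.ne' this

theorem unique {l' : Fin (n + 1) → ℝ} {U' : Matrix (Fin (n + 1)) (Fin (n + 1)) ℝ}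
    (hA : IsJacobi A) (h : IsSpectralData A l U) (h' : IsSpectralData A l' U') :
    l = l' ∧ U = U' := by
  obtain rfl := h.eigenvalues_unique h'
  exact ⟨rfl, funext fun i => h'.eq_row hA (h.mulVec_row i) (h.sum_row_mul_self i) (h.pos i)⟩

/-- A Jacobi matrix is determined by its eigenvalues and by the first coordinates of its
eigenvectors. -/
theorem jacobi_eq {A' U' : Matrix (Fin (n + 1)) (Fin (n + 1)) ℝ}
    (hA : IsJacobi A) (hA' : IsJacobi A') (h : IsSpectralData A l U)
    (h' : IsSpectralData A' l U') (h0 : ∀ i, U i 0 = U' i 0) : A = A' := by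
  have key : ∀ k : ℕ, ∀ j : Fin (n + 1), (j : ℕ) ≤ k → ∀ i, U i j = U' i j := by
    intro k
    induction k with
    | zero =>
      intro j hj
      have : j = 0 := Fin.ext (by simpa using hj)
      rw [this]; exact h0
    | succ k ih =>
      intro j hj
      by_cases hlt : (j : ℕ) ≤ k
      · exact ih j hlt
      have hjk : (j : ℕ) = k + 1 := by omega
      let m : Fin (n + 1) := ⟨k, by omega⟩
      -- Entry `(i, m)` of `V B = diag(l) V`, solved for the single term beyond column `k`.
      have split : ∀ {B V : Matrix (Fin (n + 1)) (Fin (n + 1)) ℝ}, IsJacobi B →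
          IsSpectralData B l V → ∀ i, V i j * B j m =
            l i * V i m - ∑ r ∈ Finset.univ.filter (fun r : Fin (n + 1) => (r : ℕ) ≤ k),
              V i r * B r m := by
        intro B V hB hV i
        have e := congrFun (congrFun hV.mul_eq i) m
        rw [Matrix.diagonal_mul, Matrix.mul_apply] at e
        rw [← e, ← Finset.sum_filter_add_sum_filter_not _ (fun r : Fin (n + 1) => (r : ℕ) ≤ k),
          add_sub_cancel_left]
        symm
        refine Finset.sum_eq_single j ?_ ?_
        · intro r hr hrj
          have hr' := (Finset.mem_filter.mp hr).2
          have : (r : ℕ) ≠ j := fun e => hrj (Fin.ext e)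
          rw [hB.2.1 r m (Or.inr (by simp [m]; omega)), mul_zero]
        · intro hj'
          exact absurd (Finset.mem_filter.mpr ⟨Finset.mem_univ _, by omega⟩) hj'
      have hUm : ∀ i, U i m = U' i m := ih m le_rfl
      have hprod : ∀ i, U i j * A j m = U' i j * A' j m := by
        intro i
        rw [split hA h, split hA' h', hUm]
        congr 1
        refine Finset.sum_congr rfl fun r hr => ?_
        have hr' := ih r (Finset.mem_filter.mp hr).2
        -- The entries `A r m` with `r ≤ k` are sums involving only columns of index at most `k`,
        -- already known to agree.
        rw [hr', h.apply, h'.apply]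
        simp only [hr', hUm]
      have hb : 0 < A j m := hA.2.2 j m (Or.inr (by simp [m]; omega))
      have hb' : 0 < A' j m := hA'.2.2 j m (Or.inr (by simp [m]; omega))
      -- Column `j` has norm one, so the off-diagonal entry is the norm of the common vector in
      -- `hprod`.
      have hsq : A j m ^ 2 = A' j m ^ 2 := by
        calc A j m ^ 2 = ∑ i, (U i j * A j m) * (U i j * A j m) := by
              rw [← mul_one (A j m ^ 2), ← h.sum_mul_self j, Finset.mul_sum]
              exact Finset.sum_congr rfl fun i _ => by ring
          _ = A' j m ^ 2 * ∑ i, U' i j * U' i j := by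
              rw [Finset.mul_sum]
              exact Finset.sum_congr rfl fun i _ => by rw [hprod]; ring
          _ = A' j m ^ 2 := by rw [h'.sum_mul_self, mul_one]
      have hbe : A j m = A' j m := (pow_left_inj₀ hb.le hb'.le two_ne_zero).mp hsq
      intro i
      have := hprod i
      rw [hbe] at this
      exact mul_right_cancel₀ hb'.ne' this
  have hU : U = U' := by
    ext i j
    exact key j j le_rfl i
  rw [h.eq, h'.eq, hU]

end IsSpectralData

/-! ### Existence of spectral data -/

/-- Every Jacobi matrix has simple spectrum, with eigenvectors of positive first coordinate. -/
theorem IsJacobi.exists_isSpectralData {n : ℕ} {A : Matrix (Fin (n + 1)) (Fin (n + 1)) ℝ}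
    (hA : IsJacobi A) : ∃ l U, IsSpectralData A l U := by
  have hH : A.IsHermitian := by
    rw [Matrix.IsHermitian, Matrix.conjTranspose_eq_transpose_of_trivial]; exact hA.1
  have hev := hH.mulVec_eigenvectorBasis
  have hon := hH.eigenvectorBasis.orthonormal
  have h0 : ∀ i, hH.eigenvectorBasis i 0 ≠ 0 := by
    intro i hi
    have hz := hA.eq_zero_of_mulVec_eq_smul (hev i) hi
    exact hon.ne_zero i (by ext k; exact congrFun hz k)
  have hinj : Function.Injective hH.eigenvalues := by
    intro i j hij
    by_contra hne
    have hz : hH.eigenvectorBasis i 0 • hH.eigenvectorBasis j -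
        hH.eigenvectorBasis j 0 • hH.eigenvectorBasis i = 0 := by
      ext k
      refine congrFun (hA.eq_zero_of_mulVec_eq_smul (μ := hH.eigenvalues i)
        (q := hH.eigenvectorBasis i 0 • ⇑(hH.eigenvectorBasis j) -
          hH.eigenvectorBasis j 0 • ⇑(hH.eigenvectorBasis i)) ?_ ?_) k
      · rw [Matrix.mulVec_sub, Matrix.mulVec_smul, Matrix.mulVec_smul, hev, hev, ← hij, smul_sub,
          smul_comm (hH.eigenvalues i), smul_comm (hH.eigenvalues i)]
      · simp [mul_comm]
    -- Pairing with eigenvector `j` isolates the first coordinate of eigenvector `i`, which is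
    -- nonzero.
    have := congrArg (fun x => inner ℝ (hH.eigenvectorBasis j) x) hz
    simp only [inner_sub_right, inner_smul_right, inner_zero_right, hon.2 (Ne.symm hne),
      real_inner_self_eq_norm_sq, hon.1] at this
    exact h0 i (by simpa using this)
  let s : Finset ℝ := Finset.univ.image hH.eigenvalues
  have hs : s.card = n + 1 := by
    rw [Finset.card_image_of_injective _ hinj, Finset.card_univ, Fintype.card_fin]
  let l : Fin (n + 1) → ℝ := s.orderEmbOfFin hs
  have hl : StrictMono l := (s.orderEmbOfFin hs).strictMono
  have hmem : ∀ i, ∃ j, hH.eigenvalues j = l i := by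
    intro i
    obtain ⟨j, -, hj⟩ := Finset.mem_image.mp (s.orderEmbOfFin_mem hs i)
    exact ⟨j, hj⟩
  choose σ hσ using hmem
  have hσi : Function.Injective σ := fun i j hij => hl.injective (by rw [← hσ, ← hσ, hij])
  let ε : Fin (n + 1) → ℝ := fun i => SignType.sign (hH.eigenvectorBasis (σ i) 0)
  have hε : ∀ i, ε i * ε i = 1 := by
    intro i
    rcases lt_or_gt_of_ne (h0 (σ i)) with h | h <;> simp [ε, h]
  let U : Matrix (Fin (n + 1)) (Fin (n + 1)) ℝ :=
    Matrix.of fun i k => ε i * hH.eigenvectorBasis (σ i) k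
  have hUU : U * Uᵀ = 1 := by
    ext i j
    have : (U * Uᵀ) i j =
        ε i * ε j * inner ℝ (hH.eigenvectorBasis (σ i)) (hH.eigenvectorBasis (σ j)) := by
      rw [Matrix.mul_apply, PiLp.inner_apply, Finset.mul_sum]
      refine Finset.sum_congr rfl fun k _ => ?_
      simp only [U, Matrix.transpose_apply, Matrix.of_apply, RCLike.inner_apply, conj_trivial]
      ring
    rw [this, orthonormal_iff_ite.mp hon, Matrix.one_apply]
    by_cases hij : i = j
    · simp [hij, hε]
    · simp [hij, hσi.ne hij]
  have hUtU : Uᵀ * U = 1 := mul_eq_one_comm.mp hUU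
  refine ⟨l, U, hl, hUtU, ?_, ?_⟩
  · intro i
    simp only [U, Matrix.of_apply, ε]
    rcases lt_or_gt_of_ne (h0 (σ i)) with h | h <;> simp [h]
  · have hUA : U * A = Matrix.diagonal l * U := by
      ext i k
      have e := congrFun (hev (σ i)) k
      rw [hσ, Matrix.mulVec, dotProduct, Pi.smul_apply, smul_eq_mul] at e
      rw [Matrix.diagonal_mul, Matrix.mul_apply]
      simp only [U, Matrix.of_apply]
      rw [mul_left_comm, ← e, Finset.mul_sum]
      refine Finset.sum_congr rfl fun j _ => ?_
      rw [← hA.1.apply k j]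
      ring
    rw [Matrix.mul_assoc, ← hUA, ← Matrix.mul_assoc, hUtU, Matrix.one_mul]

/-! ### Krylov vectors, Gram–Schmidt and the Lanczos matrix -/

theorem krylov_apply {n : ℕ} (l v : EuclideanSpace ℝ (Fin n)) (k i : Fin n) :
    krylov l v k i = l i ^ (k : ℕ) * v i := by
  simp [krylov, Matrix.diagonal_pow, Matrix.mulVec_diagonal]

/-- After cancelling `v j`, a linear relation says that a polynomial of degree less than `n`
vanishes at `n` distinct nodes. -/
theorem linearIndependent_krylov {n : ℕ} {l v : EuclideanSpace ℝ (Fin n)}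
    (hl : Function.Injective fun i => l i) (hv : ∀ i, v i ≠ 0) :
    LinearIndependent ℝ (krylov l v) := by
  rw [Fintype.linearIndependent_iff]
  intro g hg
  refine congrFun (Matrix.eq_zero_of_forall_index_sum_mul_pow_eq_zero hl fun j => ?_)
  have := congrArg (fun x : EuclideanSpace ℝ (Fin n) => x j) hg
  simp only [WithLp.ofLp_sum, WithLp.ofLp_smul, Finset.sum_apply, Pi.smul_apply, smul_eq_mul,
    krylov_apply, ← mul_assoc, ← Finset.sum_mul, PiLp.zero_apply] at this
  exact (mul_eq_zero.mp this).resolve_right (hv j)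

theorem inner_gramSchmidt_self {E ι : Type*} [NormedAddCommGroup E] [InnerProductSpace ℝ E]
    [LinearOrder ι] [LocallyFiniteOrderBot ι] [WellFoundedLT ι] (f : ι → E) (k : ι) :
    inner ℝ (InnerProductSpace.gramSchmidt ℝ f k) (f k) =
      ‖InnerProductSpace.gramSchmidt ℝ f k‖ ^ 2 := by
  conv_lhs => rw [InnerProductSpace.gramSchmidt_def'' ℝ f k]
  rw [inner_add_right, inner_sum, Finset.sum_eq_zero, add_zero, real_inner_self_eq_norm_sq]
  intro i hi
  rw [inner_smul_right, InnerProductSpace.gramSchmidt_orthogonal ℝ f (Finset.mem_Iio.mp hi).ne',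
    mul_zero]

theorem sub_gramSchmidt_mem_span {E ι : Type*} [NormedAddCommGroup E] [InnerProductSpace ℝ E]
    [LinearOrder ι] [LocallyFiniteOrderBot ι] [WellFoundedLT ι] (f : ι → E) (k : ι) :
    f k - InnerProductSpace.gramSchmidt ℝ f k ∈ Submodule.span ℝ (f '' Set.Iio k) := by
  rw [InnerProductSpace.gramSchmidt_def, sub_sub_cancel,
    ← InnerProductSpace.span_gramSchmidt_Iio]
  refine Submodule.sum_mem _ fun i hi => ?_
  rw [Submodule.starProjection_singleton]
  exact Submodule.smul_mem _ _ (Submodule.subset_span ⟨i, Finset.mem_Iio.mp hi, rfl⟩)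

section Lanczos

variable {n : ℕ} {l v : EuclideanSpace ℝ (Fin n)}

theorem transpose_lanczosMatrix_mul_self (hl : Function.Injective fun i => l i)
    (hv : ∀ i, v i ≠ 0) : (lanczosMatrix l v)ᵀ * lanczosMatrix l v = 1 := by
  have hon := InnerProductSpace.gramSchmidtNormed_orthonormal (linearIndependent_krylov hl hv)
  ext a b
  rw [Matrix.one_apply, ← orthonormal_iff_ite.mp hon, Matrix.mul_apply, PiLp.inner_apply]
  refine Finset.sum_congr rfl fun i _ => ?_
  simp [lanczosMatrix, mul_comm]

theorem lanczosMatrix_apply_zero {n : ℕ} {l v : EuclideanSpace ℝ (Fin (n + 1))} (hv : ‖v‖ = 1)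
    (i : Fin (n + 1)) : lanczosMatrix l v i 0 = v i := by
  have h0 : krylov l v 0 = v := by ext i; simp [krylov_apply]
  have : InnerProductSpace.gramSchmidt ℝ (krylov l v) 0 = v :=
    (InnerProductSpace.gramSchmidt_bot ℝ (krylov l v)).trans h0
  simp [lanczosMatrix, InnerProductSpace.gramSchmidtNormed, this, hv]

/-- Multiplication by the diagonal matrix `diag l`. -/
noncomputable def diagonalMap (l : EuclideanSpace ℝ (Fin n)) :
    EuclideanSpace ℝ (Fin n) →ₗ[ℝ] EuclideanSpace ℝ (Fin n) where
  toFun x := WithLp.toLp 2 fun i => l i * x i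
  map_add' x y := by ext i; simp [mul_add]
  map_smul' c x := by ext i; simp [mul_left_comm]

theorem diagonalMap_krylov {i j : Fin n} (h : (i : ℕ) + 1 = j) :
    diagonalMap l (krylov l v i) = krylov l v j := by
  ext m
  simp only [diagonalMap, LinearMap.coe_mk, AddHom.coe_mk, krylov_apply, ← h]
  ring

/-- The diagonal map sends Krylov vectors of index below `j - 1` to ones of index below `j`, all
orthogonal to the `j`-th Gram–Schmidt vector. -/
theorem inner_gramSchmidt_diagonalMap_eq_zero {j : Fin n} {x : EuclideanSpace ℝ (Fin n)}
    (hx : x ∈ Submodule.span ℝ (krylov l v '' {i | (i : ℕ) + 1 < j})) :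
    inner ℝ (InnerProductSpace.gramSchmidt ℝ (krylov l v) j) (diagonalMap l x) = 0 := by
  induction hx using Submodule.span_induction with
  | mem x hx =>
    obtain ⟨i, hi, rfl⟩ := hx
    have hi' : (i : ℕ) + 1 < j := hi
    rw [diagonalMap_krylov (j := ⟨i + 1, hi'.trans j.2⟩) rfl]
    exact InnerProductSpace.gramSchmidt_inv_triangular ℝ _ hi'
  | zero => simp
  | add x y _ _ hx hy => rw [map_add, inner_add_right, hx, hy, add_zero]
  | smul c x _ hx => rw [map_smul, inner_smul_right, hx, mul_zero]

theorem lanczos_conj_apply (j k : Fin n) :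
    ((lanczosMatrix l v)ᵀ * Matrix.diagonal l.ofLp * lanczosMatrix l v) j k =
      ‖InnerProductSpace.gramSchmidt ℝ (krylov l v) j‖⁻¹ *
      ‖InnerProductSpace.gramSchmidt ℝ (krylov l v) k‖⁻¹ *
      inner ℝ (InnerProductSpace.gramSchmidt ℝ (krylov l v) j)
        (diagonalMap l (InnerProductSpace.gramSchmidt ℝ (krylov l v) k)) := by
  rw [Matrix.mul_apply, PiLp.inner_apply, Finset.mul_sum]
  refine Finset.sum_congr rfl fun i _ => ?_
  rw [Matrix.mul_diagonal, Matrix.transpose_apply]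
  simp only [lanczosMatrix, InnerProductSpace.gramSchmidtNormed, Matrix.of_apply, diagonalMap,
    LinearMap.coe_mk, AddHom.coe_mk, RCLike.inner_apply, conj_trivial, PiLp.smul_apply,
    smul_eq_mul, RCLike.ofReal_real_eq_id, id_eq]
  ring

theorem isJacobi_lanczos (hl : Function.Injective fun i => l i) (hv : ∀ i, v i ≠ 0) :
    IsJacobi ((lanczosMatrix l v)ᵀ * Matrix.diagonal l.ofLp * lanczosMatrix l v) := by
  have hs : ((lanczosMatrix l v)ᵀ * Matrix.diagonal l.ofLp * lanczosMatrix l v).IsSymm := by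
    rw [Matrix.IsSymm]
    simp [Matrix.transpose_mul, Matrix.mul_assoc]
  have hne := fun k => InnerProductSpace.gramSchmidt_ne_zero k (linearIndependent_krylov hl hv)
  have hzero : ∀ j k : Fin n, (k : ℕ) + 1 < j →
      ((lanczosMatrix l v)ᵀ * Matrix.diagonal l.ofLp * lanczosMatrix l v) j k = 0 := by
    intro j k hjk
    rw [lanczos_conj_apply, inner_gramSchmidt_diagonalMap_eq_zero, mul_zero]
    refine Submodule.span_mono (Set.image_mono ?_)
      (InnerProductSpace.gramSchmidt_mem_span ℝ (krylov l v) (le_refl k))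
    intro i (hi : i ≤ k)
    have : (i : ℕ) ≤ k := hi
    exact show (i : ℕ) + 1 < j by omega
  have hpos : ∀ j k : Fin n, (k : ℕ) + 1 = j →
      0 < ((lanczosMatrix l v)ᵀ * Matrix.diagonal l.ofLp * lanczosMatrix l v) j k := by
    intro j k hjk
    have hj := norm_pos_iff.mpr (hne j)
    have hk := norm_pos_iff.mpr (hne k)
    -- Replacing the `k`-th Gram–Schmidt vector by the Krylov vector changes nothing in this
    -- pairing, and the diagonal map takes that Krylov vector to the `j`-th one. The entry is
    -- therefore the ratio of the `j`-th to the `k`-th Gram–Schmidt norm.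
    have hz : inner ℝ (InnerProductSpace.gramSchmidt ℝ (krylov l v) j) (diagonalMap l
        (krylov l v k - InnerProductSpace.gramSchmidt ℝ (krylov l v) k)) = 0 := by
      refine inner_gramSchmidt_diagonalMap_eq_zero (Submodule.span_mono (Set.image_mono ?_)
        (sub_gramSchmidt_mem_span (krylov l v) k))
      intro i (hi : i < k)
      have : (i : ℕ) < k := hi
      exact show (i : ℕ) + 1 < j by omega
    rw [map_sub, inner_sub_right, diagonalMap_krylov hjk, inner_gramSchmidt_self,
      sub_eq_zero] at hz
    rw [lanczos_conj_apply, ← hz]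
    positivity
  refine ⟨hs, fun i j h => ?_, fun i j h => ?_⟩
  · rcases h with h | h
    · rw [← hs.apply]; exact hzero j i h
    · exact hzero i j h
  · rcases h with h | h
    · rw [← hs.apply]; exact hpos j i h
    · exact hpos i j h

end Lanczos

theorem isSpectralData_lanczos {n : ℕ} {l v : EuclideanSpace ℝ (Fin (n + 1))}
    (hl : StrictMono fun i => l i) (hv : ∀ i, 0 < v i) (hv1 : ‖v‖ = 1) :
    IsSpectralData ((lanczosMatrix l v)ᵀ * Matrix.diagonal l.ofLp * lanczosMatrix l v)
      l.ofLp (lanczosMatrix l v) where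
  strictMono := hl
  transpose_mul_self := transpose_lanczosMatrix_mul_self hl.injective fun i => (hv i).ne'
  pos i := by rw [lanczosMatrix_apply_zero hv1]; exact hv i
  eq := rfl

/-! ### Smoothness tools -/

/-- Each step divides only by squared norms of earlier Gram–Schmidt vectors, nonzero at `x` by
independence. -/
theorem ContDiffAt.gramSchmidt {X E ι : Type*} [NormedAddCommGroup X] [NormedSpace ℝ X]
    [NormedAddCommGroup E] [InnerProductSpace ℝ E] [LinearOrder ι] [LocallyFiniteOrderBot ι]
    [WellFoundedLT ι] {m : ℕ∞ω} {f : X → ι → E} {x : X}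
    (hf : ∀ i, ContDiffAt ℝ m (fun y => f y i) x) (hx : LinearIndependent ℝ (f x)) (k : ι) :
    ContDiffAt ℝ m (fun y => InnerProductSpace.gramSchmidt ℝ (f y) k) x := by
  induction k using WellFoundedLT.induction with
  | ind k ih =>
    simp only [InnerProductSpace.gramSchmidt_def ℝ _ k, Submodule.starProjection_singleton,
      RCLike.ofReal_real_eq_id, id_eq]
    refine (hf k).sub (ContDiffAt.sum fun i hi => ?_)
    have hi' := ih i (Finset.mem_Iio.mp hi)
    refine ContDiffAt.smul (ContDiffAt.div (hi'.inner ℝ (hf k)) (hi'.norm_sq ℝ) ?_) hi'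
    exact pow_ne_zero 2 (norm_ne_zero_iff.mpr (InnerProductSpace.gramSchmidt_ne_zero i hx))

theorem contDiffAt_lanczosMatrix {n : ℕ} {m : ℕ∞ω}
    {p : EuclideanSpace ℝ (Fin n) × EuclideanSpace ℝ (Fin n)}
    (hl : Function.Injective fun i => p.1 i) (hv : ∀ i, p.2 i ≠ 0) (i k : Fin n) :
    ContDiffAt ℝ m (fun y : EuclideanSpace ℝ (Fin n) × EuclideanSpace ℝ (Fin n) =>
      lanczosMatrix y.1 y.2 i k) p := by
  have hli := linearIndependent_krylov hl hv
  have hK : ∀ j, ContDiffAt ℝ m (fun y : EuclideanSpace ℝ (Fin n) × EuclideanSpace ℝ (Fin n) =>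
      krylov y.1 y.2 j) p := by
    intro j
    rw [contDiffAt_euclidean]
    intro i
    simp only [krylov_apply]
    fun_prop
  have hg := ContDiffAt.gramSchmidt hK hli k
  have hne := InnerProductSpace.gramSchmidt_ne_zero k hli
  have : ContDiffAt ℝ m (fun y : EuclideanSpace ℝ (Fin n) × EuclideanSpace ℝ (Fin n) =>
      InnerProductSpace.gramSchmidtNormed ℝ (krylov y.1 y.2) k) p := by
    simp only [InnerProductSpace.gramSchmidtNormed, RCLike.ofReal_real_eq_id, id_eq]
    exact ((hg.norm ℝ hne).inv (norm_ne_zero_iff.mpr hne)).smul hg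
  exact contDiffAt_euclidean.mp this i

theorem contDiffAt_lanczos_conj {n : ℕ} {m : ℕ∞ω}
    {p : EuclideanSpace ℝ (Fin n) × EuclideanSpace ℝ (Fin n)}
    (hl : Function.Injective fun i => p.1 i) (hv : ∀ i, p.2 i ≠ 0) :
    ContDiffAt ℝ m (fun y : EuclideanSpace ℝ (Fin n) × EuclideanSpace ℝ (Fin n) =>
      (fun j k => ((lanczosMatrix y.1 y.2)ᵀ * Matrix.diagonal y.1.ofLp * lanczosMatrix y.1 y.2) j k :
        Fin n → Fin n → ℝ)) p := by
  rw [contDiffAt_pi]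
  intro j
  rw [contDiffAt_pi]
  intro k
  simp only [Matrix.mul_apply (M := _ * _), Matrix.mul_diagonal, Matrix.transpose_apply]
  refine ContDiffAt.sum fun i _ => ((contDiffAt_lanczosMatrix hl hv i j).mul ?_).mul
    (contDiffAt_lanczosMatrix hl hv i k)
  fun_prop

theorem ContDiffAt.matrix_det {X ι : Type*} [NormedAddCommGroup X] [NormedSpace ℝ X] [Fintype ι]
    [DecidableEq ι] {m : ℕ∞ω} {M : X → Matrix ι ι ℝ} {x : X}
    (hM : ∀ i j, ContDiffAt ℝ m (fun y => M y i j) x) :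
    ContDiffAt ℝ m (fun y => (M y).det) x := by
  simp only [Matrix.det_apply']
  exact ContDiffAt.sum fun σ _ => contDiffAt_const.mul (contDiffAt_prod fun i _ => hM _ _)

theorem contDiff_matrix_pow_apply {ι : Type*} [Fintype ι] [DecidableEq ι] {m : ℕ∞ω} (j : ℕ)
    (a b : ι) : ContDiff ℝ m (fun A : ι → ι → ℝ => (Matrix.of A ^ j) a b) := by
  induction j generalizing a b with
  | zero => simp only [pow_zero]; exact contDiff_const
  | succ j ih =>
    simp only [pow_succ, Matrix.mul_apply, Matrix.of_apply]
    refine ContDiff.sum fun i _ => (ih a i).mul ?_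
    fun_prop

/-- Smooth dependence of a simple zero on parameters. -/
theorem exists_contDiffAt_zero {X : Type*} [NormedAddCommGroup X] [NormedSpace ℝ X]
    [CompleteSpace X] {m : ℕ∞ω} (hm : m ≠ 0) {f : X × ℝ → ℝ} {a : X} {t c : ℝ}
    (hf : ContDiffAt ℝ m f (a, t)) (hc : c ≠ 0) (h0 : f (a, t) = 0)
    (hd : HasDerivAt (fun s => f (a, s)) c t) :
    ∃ ψ : X → ℝ, ψ a = t ∧ ContDiffAt ℝ m ψ a ∧ ∀ᶠ y in nhds a, f (y, ψ y) = 0 := by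
  have hfd := (hf.differentiableAt hm).hasFDerivAt
  have hd' : HasDerivAt (fun s => f (a, s)) (fderiv ℝ f (a, t) (0, 1)) t :=
    HasFDerivAt.comp_hasDerivAt (f := fun s => (a, s)) t hfd
      ((hasDerivAt_const t a).prodMk (hasDerivAt_id t))
  have hcv := hd'.unique hd
  -- The partial derivative in the last variable is multiplication by `c`, inverted by `c⁻¹`.
  have hinv : (fderiv ℝ f (a, t) ∘L .inr ℝ X ℝ).IsInvertible := by
    refine ContinuousLinearMap.IsInvertible.of_inverse (g := c⁻¹ • .id ℝ ℝ) ?_ ?_ <;>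
    · ext
      simp [hcv, hc]
  refine ⟨hf.implicitFunction hm hinv, hf.implicitFunction_apply_self hm hinv,
    hf.contDiffAt_implicitFunction hm hinv, ?_⟩
  have := hf.eventually_apply_implicitFunction hm hinv
  rwa [h0] at this

theorem hasDerivAt_prod_sub {ι : Type*} [Fintype ι] [DecidableEq ι] (l : ι → ℝ) (i : ι) :
    HasDerivAt (fun x => ∏ j, (x - l j)) (∏ j ∈ Finset.univ.erase i, (l i - l j)) (l i) := by
  have h1 : HasDerivAt (fun x => x - l i) 1 (l i) := (hasDerivAt_id _).sub_const _
  have h2 : DifferentiableAt ℝ (fun x => ∏ j ∈ Finset.univ.erase i, (x - l j)) (l i) := by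
    fun_prop
  have := h1.mul h2.hasDerivAt
  simp only [sub_self, zero_mul, add_zero, one_mul] at this
  refine this.congr_of_eventuallyEq (Filter.Eventually.of_forall fun x => ?_)
  exact (Finset.mul_prod_erase Finset.univ (fun j => x - l j) (Finset.mem_univ i)).symm

/-! ### Smoothness of the spectral map -/

section Forward

variable {n : ℕ}

theorem isJacobi_jacobiToMatrix (J : JacobiMatrices n) : IsJacobi (jacobiToMatrix J) := J.2

/-- The increasing tuple of eigenvalues of a Jacobi matrix. -/
noncomputable def jacobiEigenvalues (J : JacobiMatrices (n + 1)) : EuclideanSpace ℝ (Fin (n + 1)) :=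
  WithLp.toLp 2 (isJacobi_jacobiToMatrix J).exists_isSpectralData.choose

/-- The orthogonal matrix whose rows are the normalized eigenvectors of a Jacobi matrix. -/
noncomputable def jacobiEigenvectors (J : JacobiMatrices (n + 1)) :
    Matrix (Fin (n + 1)) (Fin (n + 1)) ℝ :=
  (isJacobi_jacobiToMatrix J).exists_isSpectralData.choose_spec.choose

theorem isSpectralData_jacobi (J : JacobiMatrices (n + 1)) :
    IsSpectralData (jacobiToMatrix J) (jacobiEigenvalues J).ofLp (jacobiEigenvectors J) :=
  (isJacobi_jacobiToMatrix J).exists_isSpectralData.choose_spec.choose_spec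

/-- The first coordinates of the normalized eigenvectors of a Jacobi matrix. -/
noncomputable def jacobiWeights (J : JacobiMatrices (n + 1)) : EuclideanSpace ℝ (Fin (n + 1)) :=
  WithLp.toLp 2 fun i => jacobiEigenvectors J i 0

theorem jacobiEigenvalues_mem (J : JacobiMatrices (n + 1)) :
    jacobiEigenvalues J ∈ OrderedTuples (n + 1) :=
  (isSpectralData_jacobi J).strictMono

theorem jacobiWeights_mem_sphere (J : JacobiMatrices (n + 1)) :
    jacobiWeights J ∈ Metric.sphere (0 : EuclideanSpace ℝ (Fin (n + 1))) 1 := by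
  rw [mem_sphere_zero_iff_norm, EuclideanSpace.norm_eq, Real.sqrt_eq_one]
  simpa [jacobiWeights, ← sq] using (isSpectralData_jacobi J).sum_mul_self 0

/-- The implicit function theorem follows each simple root separately. Near `J` the branches stay
strictly ordered, so together they are the whole increasing list of eigenvalues. -/
theorem eventually_spectrum_eq (J : JacobiMatrices (n + 1)) :
    ∃ ψ : Fin (n + 1) → SymTridiagonal (n + 1) → ℝ, (∀ i, ContDiffAt ℝ ∞ (ψ i) J.1) ∧
      ∀ᶠ K : JacobiMatrices (n + 1) in nhds J, ∀ i, ψ i K.1 = jacobiEigenvalues K i := by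
  let F : SymTridiagonal (n + 1) × ℝ → ℝ := fun p =>
    (Matrix.scalar _ p.2 - Matrix.of p.1.1).det
  have hF : ∀ p, ContDiffAt ℝ ∞ F p := by
    intro p
    refine ContDiffAt.matrix_det fun i j => ?_
    simp only [Matrix.sub_apply, Matrix.scalar_apply, Matrix.diagonal_apply, Matrix.of_apply]
    refine ContDiffAt.sub ?_ ?_
    · split_ifs <;> fun_prop
    · have h1 : ContDiff ℝ ∞ fun A : Fin (n + 1) → Fin (n + 1) → ℝ => A i j := by fun_prop
      have h2 : ContDiff ℝ ∞ fun p : SymTridiagonal (n + 1) × ℝ => p.1.1 :=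
        (SymTridiagonal (n + 1)).subtypeL.contDiff.comp contDiff_fst
      exact (h1.comp h2).contDiffAt
  have hFJ : ∀ (K : JacobiMatrices (n + 1)) (x : ℝ),
      F (K.1, x) = ∏ j, (x - jacobiEigenvalues K j) :=
    fun K x => (isSpectralData_jacobi K).charpoly_eq x
  have hl := (isSpectralData_jacobi J).strictMono
  have hex : ∀ i, ∃ ψ : SymTridiagonal (n + 1) → ℝ, ψ J.1 = jacobiEigenvalues J i ∧
      ContDiffAt ℝ ∞ ψ J.1 ∧ ∀ᶠ y in nhds J.1, F (y, ψ y) = 0 := by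
    intro i
    refine exists_contDiffAt_zero (by simp) (hF _)
      (c := ∏ j ∈ Finset.univ.erase i, (jacobiEigenvalues J i - jacobiEigenvalues J j)) ?_ ?_ ?_
    · refine Finset.prod_ne_zero_iff.mpr fun j hj => sub_ne_zero.mpr fun e => ?_
      exact Finset.ne_of_mem_erase hj (hl.injective e).symm
    · rw [hFJ]
      exact Finset.prod_eq_zero (Finset.mem_univ i) (sub_self _)
    · simp only [hFJ]
      exact hasDerivAt_prod_sub _ i
  choose ψ hψJ hψ hψ0 using hex
  refine ⟨ψ, hψ, ?_⟩
  have hc : ContinuousAt (Subtype.val : JacobiMatrices (n + 1) → SymTridiagonal (n + 1)) J :=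
    continuous_subtype_val.continuousAt
  have hmono : ∀ᶠ y in nhds J.1, ∀ i j, i < j → ψ i y < ψ j y := by
    refine Filter.eventually_all.mpr fun i => Filter.eventually_all.mpr fun j => ?_
    by_cases hij : i < j
    · have := (hψ i).continuousAt.eventually_lt (hψ j).continuousAt
        (by rw [hψJ, hψJ]; exact hl hij)
      exact this.mono fun _ h _ => h
    · exact Filter.Eventually.of_forall fun _ h => absurd h hij
  filter_upwards [hc.eventually (Filter.eventually_all.mpr hψ0), hc.eventually hmono]
    with K h0 hm
  have hr : ∀ i, ∃ j, jacobiEigenvalues K j = ψ i K.1 := by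
    intro i
    have := h0 i
    rw [hFJ] at this
    obtain ⟨j, -, hj⟩ := Finset.prod_eq_zero_iff.mp this
    exact ⟨j, (sub_eq_zero.mp hj).symm⟩
  choose τ hτ using hr
  have hm' : StrictMono fun i => ψ i K.1 := fun i j hij => hm i j hij
  -- Distinct roots, as many as there are eigenvalues, exhaust them.
  have hτs : Function.Surjective τ := Finite.surjective_of_injective fun i j hij =>
    hm'.injective (by simp only [← hτ, hij])
  have : (fun i => ψ i K.1) = (jacobiEigenvalues K).ofLp := by
    refine (hm'.range_inj (isSpectralData_jacobi K).strictMono).mp ?_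
    have : (fun i => ψ i K.1) = (jacobiEigenvalues K).ofLp ∘ τ := funext fun i => (hτ i).symm
    rw [this, hτs.range_comp]
  exact congrFun this

theorem contMDiff_jacobiEigenvalues :
    ContMDiff 𝓘(ℝ, SymTridiagonal (n + 1)) 𝓘(ℝ, EuclideanSpace ℝ (Fin (n + 1))) ∞
      (jacobiEigenvalues (n := n)) := by
  intro J
  obtain ⟨ψ, hψ, he⟩ := eventually_spectrum_eq J
  have h1 : ContDiffAt ℝ ∞ (fun A => (WithLp.toLp 2 fun i => ψ i A :
      EuclideanSpace ℝ (Fin (n + 1)))) J.1 := contDiffAt_euclidean.mpr hψ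
  refine (contMDiffAt_subtype_iff.mpr h1.contMDiffAt).congr_of_eventuallyEq ?_
  filter_upwards [he] with K hK
  ext i
  exact (hK i).symm

/-- The squared weights of a Jacobi matrix as the solution, by Cramer's rule, of the Vandermonde
system given by the moments `(A ^ j) 0 0`. -/
noncomputable def weightOfMoments (A : Fin (n + 1) → Fin (n + 1) → ℝ)
    (l : EuclideanSpace ℝ (Fin (n + 1))) (i : Fin (n + 1)) : ℝ :=
  (Matrix.vandermonde l.ofLp).det⁻¹ *
    ((Matrix.vandermonde l.ofLp)ᵀ.updateCol i fun j => (Matrix.of A ^ (j : ℕ)) 0 0).det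

theorem weightOfMoments_jacobi (J : JacobiMatrices (n + 1)) (i : Fin (n + 1)) :
    weightOfMoments J.1.1 (jacobiEigenvalues J) i = jacobiWeights J i ^ 2 := by
  have hdet := Matrix.det_vandermonde_ne_zero_iff.mpr
    (isSpectralData_jacobi J).strictMono.injective
  have hm : (fun j : Fin (n + 1) => (Matrix.of J.1.1 ^ (j : ℕ)) 0 0) =
      (Matrix.vandermonde (jacobiEigenvalues J).ofLp)ᵀ *ᵥ fun i => jacobiWeights J i ^ 2 :=
    funext fun j => (isSpectralData_jacobi J).pow_apply_zero_zero j
  -- Cramer's determinant is a coordinate of the adjugate applied to the moments; adjugate times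
  -- matrix is the determinant, which the prefactor cancels.
  rw [weightOfMoments, hm, ← Matrix.cramer_apply, Matrix.cramer_eq_adjugate_mulVec,
    Matrix.mulVec_mulVec, Matrix.adjugate_mul, Matrix.det_transpose]
  simp [Matrix.smul_mulVec, hdet]

theorem contDiffAt_weightOfMoments {m : ℕ∞ω}
    {p : SymTridiagonal (n + 1) × EuclideanSpace ℝ (Fin (n + 1))}
    (hp : Function.Injective p.2.ofLp) (i : Fin (n + 1)) :
    ContDiffAt ℝ m (fun y : SymTridiagonal (n + 1) × EuclideanSpace ℝ (Fin (n + 1)) =>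
      weightOfMoments y.1.1 y.2 i) p := by
  have hA : ContDiff ℝ m fun y : SymTridiagonal (n + 1) × EuclideanSpace ℝ (Fin (n + 1)) =>
      y.1.1 := (SymTridiagonal (n + 1)).subtypeL.contDiff.comp contDiff_fst
  refine ContDiffAt.mul (ContDiffAt.inv (ContDiffAt.matrix_det fun a b => ?_)
    (Matrix.det_vandermonde_ne_zero_iff.mpr hp)) (ContDiffAt.matrix_det fun a b => ?_)
  · simp only [Matrix.vandermonde_apply]
    fun_prop
  · simp only [Matrix.updateCol_apply, Matrix.transpose_apply, Matrix.vandermonde_apply]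
    split_ifs
    · exact ((contDiff_matrix_pow_apply _ _ _).comp hA).contDiffAt
    · fun_prop

theorem contMDiff_jacobiWeights :
    ContMDiff 𝓘(ℝ, SymTridiagonal (n + 1)) 𝓘(ℝ, EuclideanSpace ℝ (Fin (n + 1))) ∞
      (jacobiWeights (n := n)) := by
  intro J
  have hpos : ∀ K : JacobiMatrices (n + 1), ∀ i, 0 < jacobiWeights K i :=
    fun K => (isSpectralData_jacobi K).pos
  have h1 : ContDiffAt ℝ ∞ (fun y : SymTridiagonal (n + 1) × EuclideanSpace ℝ (Fin (n + 1)) =>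
      (WithLp.toLp 2 fun i => Real.sqrt (weightOfMoments y.1.1 y.2 i) :
        EuclideanSpace ℝ (Fin (n + 1)))) (J.1, jacobiEigenvalues J) := by
    refine contDiffAt_euclidean.mpr fun i => ContDiffAt.sqrt
      (contDiffAt_weightOfMoments (isSpectralData_jacobi J).strictMono.injective i) ?_
    rw [weightOfMoments_jacobi]
    exact (pow_pos (hpos J i) 2).ne'
  have h2 : ContMDiffAt 𝓘(ℝ, SymTridiagonal (n + 1))
      𝓘(ℝ, SymTridiagonal (n + 1) × EuclideanSpace ℝ (Fin (n + 1))) ∞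
      (fun K : JacobiMatrices (n + 1) => (K.1, jacobiEigenvalues K)) J :=
    (contMDiff_subtype_val J).prodMk_space (contMDiff_jacobiEigenvalues J)
  have h3 := ContMDiffAt.comp J (h1.contMDiffAt) h2
  refine h3.congr_of_eventuallyEq (Filter.Eventually.of_forall fun K => ?_)
  ext i
  simp only [Function.comp_apply, weightOfMoments_jacobi]
  exact (Real.sqrt_sq (hpos K i).le).symm

/-- The spectral map, sending a Jacobi matrix to its eigenvalues and its weights. -/
noncomputable def jacobiSpectralMap (J : JacobiMatrices (n + 1)) :
    OrderedTuples (n + 1) × PositiveSphere n :=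
  (⟨jacobiEigenvalues J, jacobiEigenvalues_mem J⟩,
    ⟨⟨jacobiWeights J, jacobiWeights_mem_sphere J⟩, (isSpectralData_jacobi J).pos⟩)

theorem contMDiff_jacobiSpectralMap :
    ContMDiff 𝓘(ℝ, SymTridiagonal (n + 1)) (𝓘(ℝ, EuclideanSpace ℝ (Fin (n + 1))).prod (𝓡 n)) ∞
      (jacobiSpectralMap (n := n)) := by
  refine ContMDiff.prodMk ?_ ?_
  · exact (ContMDiff.subtypeVal_comp_iff (OrderedTuples (n + 1)) _).mp contMDiff_jacobiEigenvalues
  · have := Fact.mk (@finrank_euclideanSpace_fin ℝ _ (n + 1))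
    exact (ContMDiff.subtypeVal_comp_iff (PositiveSphere n) _).mp
      (contMDiff_jacobiWeights.codRestrict_sphere jacobiWeights_mem_sphere)

/-! ### The inverse map and the diffeomorphism -/

/-- The Lanczos map, sending eigenvalues `l` and weights `v` to the Jacobi matrix `Qᵀ diag(l) Q`. -/
noncomputable def lanczosMap (p : OrderedTuples (n + 1) × PositiveSphere n) :
    JacobiMatrices (n + 1) :=
  have h := isJacobi_lanczos (l := p.1.1) (v := p.2.1.1) p.1.2.injective fun i => (p.2.2 i).ne'
  ⟨⟨(lanczosMatrix p.1.1 p.2.1.1)ᵀ * Matrix.diagonal p.1.1.ofLp * lanczosMatrix p.1.1 p.2.1.1,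
    h.1, h.2.1⟩, h⟩

theorem isSpectralData_lanczosMap (p : OrderedTuples (n + 1) × PositiveSphere n) :
    IsSpectralData (jacobiToMatrix (lanczosMap p)) p.1.1.ofLp (lanczosMatrix p.1.1 p.2.1.1) :=
  isSpectralData_lanczos p.1.2 p.2.2 (mem_sphere_zero_iff_norm.mp p.2.1.2)

theorem contMDiff_lanczosMap :
    ContMDiff (𝓘(ℝ, EuclideanSpace ℝ (Fin (n + 1))).prod (𝓡 n)) 𝓘(ℝ, SymTridiagonal (n + 1)) ∞
      (lanczosMap (n := n)) := by
  refine (ContMDiff.subtypeVal_comp_iff (JacobiMatrices (n + 1)) _).mp ?_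
  -- The smooth formula takes values in all arrays. A continuous linear projection onto the
  -- symmetric tridiagonal ones corrects its codomain and fixes every value of `lanczosMap`.
  obtain ⟨P, hP⟩ := Submodule.ClosedComplemented.of_finiteDimensional_quotient
    (SymTridiagonal (n + 1)).closed_of_finiteDimensional
  have := Fact.mk (@finrank_euclideanSpace_fin ℝ _ (n + 1))
  intro p
  have h1 := contDiffAt_lanczos_conj (m := ∞) (p := (p.1.1, p.2.1.1)) p.1.2.injective
    fun i => (p.2.2 i).ne'
  have h2 := P.contDiff.contDiffAt.comp _ h1
  have h3 : ContMDiffAt (𝓘(ℝ, EuclideanSpace ℝ (Fin (n + 1))).prod (𝓡 n))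
      𝓘(ℝ, EuclideanSpace ℝ (Fin (n + 1)) × EuclideanSpace ℝ (Fin (n + 1))) ∞
      (fun q : OrderedTuples (n + 1) × PositiveSphere n => (q.1.1, q.2.1.1)) p := by
    refine ContMDiffAt.prodMk_space ?_ ?_
    · exact (contMDiff_subtype_val.comp contMDiff_fst) p
    · exact (contMDiff_coe_sphere.comp (contMDiff_subtype_val.comp contMDiff_snd)) p
  refine (ContMDiffAt.comp p h2.contMDiffAt h3).congr_of_eventuallyEq
    (Filter.Eventually.of_forall fun q => ?_)
  exact (hP (lanczosMap q).1).symm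

/-- Both matrices have the same eigenvalues and weights, so `jacobi_eq` applies. -/
theorem lanczosMap_jacobiSpectralMap (J : JacobiMatrices (n + 1)) :
    lanczosMap (jacobiSpectralMap J) = J := by
  have h1 := isSpectralData_lanczosMap (jacobiSpectralMap J)
  have h2 := isSpectralData_jacobi J
  have h0 : ∀ i, lanczosMatrix (jacobiEigenvalues J) (jacobiWeights J) i 0 =
      jacobiEigenvectors J i 0 := fun i =>
    lanczosMatrix_apply_zero (mem_sphere_zero_iff_norm.mp (jacobiWeights_mem_sphere J)) i
  have h : jacobiToMatrix (lanczosMap (jacobiSpectralMap J)) = jacobiToMatrix J :=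
    h1.jacobi_eq (isJacobi_jacobiToMatrix _) (isJacobi_jacobiToMatrix J) h2 h0
  exact Subtype.ext (Subtype.ext h)

/-- The Lanczos matrix is itself spectral data with first column `v`; uniqueness identifies it with
the chosen one. -/
theorem jacobiSpectralMap_lanczosMap (p : OrderedTuples (n + 1) × PositiveSphere n) :
    jacobiSpectralMap (lanczosMap p) = p := by
  obtain ⟨hl, hU⟩ := IsSpectralData.unique (isJacobi_jacobiToMatrix _)
    (isSpectralData_jacobi (lanczosMap p)) (isSpectralData_lanczosMap p)
  refine Prod.ext (Subtype.ext ?_) (Subtype.ext (Subtype.ext ?_))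
  · ext i
    exact congrFun hl i
  · ext i
    change jacobiEigenvectors (lanczosMap p) i 0 = _
    rw [hU]
    exact lanczosMatrix_apply_zero (mem_sphere_zero_iff_norm.mp p.2.1.2) i

/-- The diffeomorphism between Jacobi matrices and their spectral data. -/
noncomputable def jacobiDiffeomorph (n : ℕ) :
    Diffeomorph 𝓘(ℝ, SymTridiagonal (n + 1)) (𝓘(ℝ, EuclideanSpace ℝ (Fin (n + 1))).prod (𝓡 n))
      (JacobiMatrices (n + 1)) (OrderedTuples (n + 1) × PositiveSphere n) ∞ where
  toFun := jacobiSpectralMap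
  invFun := lanczosMap
  left_inv := lanczosMap_jacobiSpectralMap
  right_inv := jacobiSpectralMap_lanczosMap
  contMDiff_toFun := contMDiff_jacobiSpectralMap
  contMDiff_invFun := contMDiff_lanczosMap

end Forward

/-- For matrices of size `n + 1`, that is, of every positive size. -/
theorem mainTheorem2 (n : ℕ) :
    ∃ Φ : Diffeomorph 𝓘(ℝ, SymTridiagonal (n + 1))
        (𝓘(ℝ, EuclideanSpace ℝ (Fin (n + 1))).prod (𝓡 n))
        (JacobiMatrices (n + 1)) (OrderedTuples (n + 1) × PositiveSphere n) ∞,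
      -- the first component of `Φ J` is the increasing tuple of the eigenvalues of `J`
      (∀ J : JacobiMatrices (n + 1),
        Set.range (fun i => (Φ J).1.1 i) = spectrum ℝ (jacobiToMatrix J)) ∧
      -- the second component of `Φ J` consists of the first coordinates of the associated
      -- unit eigenvectors, taken with the sign that makes the first coordinate positive
      (∀ (J : JacobiMatrices (n + 1)) (i : Fin (n + 1)),
        (∃ q : EuclideanSpace ℝ (Fin (n + 1)),
          jacobiToMatrix J *ᵥ q.ofLp = (Φ J).1.1 i • q.ofLp ∧ ‖q‖ = 1 ∧ 0 < q 0) ∧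
        (∀ q : EuclideanSpace ℝ (Fin (n + 1)),
          jacobiToMatrix J *ᵥ q.ofLp = (Φ J).1.1 i • q.ofLp → ‖q‖ = 1 → 0 < q 0 →
            q 0 = (Φ J).2.1.1 i)) ∧
      -- the inverse map is `(Λ, v) ↦ Qᵀ Λ Q` with `Q` orthogonal
      (∀ (l : OrderedTuples (n + 1)) (v : PositiveSphere n),
        lanczosMatrix l.1 v.1.1 ∈ Matrix.orthogonalGroup (Fin (n + 1)) ℝ ∧
        jacobiToMatrix (Φ.symm (l, v)) =
          (lanczosMatrix l.1 v.1.1)ᵀ * Matrix.diagonal l.1.ofLp * lanczosMatrix l.1 v.1.1) := by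
  have hsq : ∀ q : EuclideanSpace ℝ (Fin (n + 1)), ‖q‖ ^ 2 = ∑ k, q k * q k := by
    intro q
    simp [EuclideanSpace.norm_sq_eq, ← sq]
  refine ⟨jacobiDiffeomorph n, fun J => (isSpectralData_jacobi J).spectrum_eq.symm,
    fun J i => ⟨?_, ?_⟩, fun l v => ⟨?_, rfl⟩⟩
  · have h := isSpectralData_jacobi J
    refine ⟨WithLp.toLp 2 (jacobiEigenvectors J i), h.mulVec_row i, ?_, h.pos i⟩
    rw [← sq_eq_sq₀ (norm_nonneg _) zero_le_one, hsq, one_pow]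
    exact h.sum_row_mul_self i
  · intro q hq h1 h0
    have h := (isSpectralData_jacobi J).eq_row (isJacobi_jacobiToMatrix J) hq (by rw [← hsq, h1, one_pow]) h0
    exact congrFun h 0
  · exact (Matrix.mem_orthogonalGroup_iff' _ _).mpr (isSpectralData_lanczosMap (l, v)).transpose_mul_self
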